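/- Let $p,q\ge 0$ be integers, let $I=[0,1]$, let $\Omega\subset\mathbb R^p$ be a bounded domain (non-empty, open and connected) and let $D\subset\mathbb R^q$ be closed (for instance compact, or all of $\mathbb R^q$). Let $\mathcal P(D)$ be the space of Borel probability measures on $D$ with the narrow topology, write $\xi=(t,c)\in I\times\Omega$, and let $|\cdot|$ be the Euclidean (Frobenius) norm of $q\times(p+1)$ matrices. For $\mu\colon I\times\Omega\to\mathcal P(D)$ and a Borel matrix field $v\colon (I\times\Omega)\times D\to\mathbb R^{q\times(p+1)}$ with columns $v^0,\dots,v^p$, the pair $(\mu,v)$ is a solution of the generalized continuity equation $\nabla_\xi\mu+\operatorname{div}_x(\mu v)=0$ if $\mu$ is Borel, $\int_{I\times\Omega}\int_D|v(\xi,x)|^2\,d\mu_\xi(x)\,d\xi<\infty$ and $$\int_{I\times\Omega}\int_D\sum_{i=0}^p\bigl(\partial_{\xi^i}\varphi^i(\xi,x)+\langle\nabla_x\varphi^i(\xi,x),v^i(\xi,x)\rangle\bigr)\,d\mu_\xi(x)\,d\xi=0$$ for all $\varphi\in C_c^\infty\bigl((0,1)\times\Omega\times\mathbb R^q;\mathbb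 R^{p+1}\bigr)$. The Dirichlet energy of $\mu$ is $$\mathrm{Dir}_{I\times\Omega}(\mu)=\inf\Bigl\{\tfrac12\int_{I\times\Omega}\int_D|v(\xi,x)|^2\,d\mu_\xi(x)\,d\xi\ :\ (\mu,v)\text{ is a solution}\Bigr\}\in[0,\infty],\qquad \inf\emptyset=\infty .$$ (i) Let $Q$ be a probability measure on the space of differentiable maps $\psi\colon I\times\Omega\to D$ (with the $\sigma$-algebra generated by the evaluations $\psi\mapsto\psi(t,c)$), and let $\mu_{t,c}=\mathbb E_{\psi\sim Q}[\delta_{\psi(t,c)}]$ for all $(t,c)\in I\times\Omega$. Then $$\mathrm{Dir}_{I\times\Omega}(\mu)\le\iint_{I\times\Omega}\mathbb E_{\psi\sim Q}|\nabla_{t,c}\psi(t,c)|^2\,dt\,dc .$$ (ii) Let $Q$ be a Borel probability measure on the Sobolev space $H^1(I\times\Omega;D)$ (the maps in $H^1(I\times\Omega;\mathbb R^q)$ with values in $D$ almost everywhere), and let $\mu\colon I\times\Omega\to\mathcal P(D)$ be Borel with $\mu_{t,c}=\mathbb E_{\psi\sim Q}[\delta_{\psi(t,c)}]$ for almost every $(t,c)$,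 in the sense that $\mu_\xi(dx)\,d\xi=\mathbb E_{\psi\sim Q}[\delta_{\psi(\xi)}(dx)\,d\xi]$ as measures on $(I\times\Omega)\times\mathbb R^q$. Then, with the weak gradient $\nabla_{t,c}\psi$, $$\mathrm{Dir}_{I\times\Omega}(\mu)\le\mathbb E_{\psi\sim Q}\iint_{I\times\Omega}|\nabla_{t,c}\psi(t,c)|^2\,dt\,dc .$$ The right-hand sides may be infinite. -/

import Mathlib

open MeasureTheory Set
open scoped ENNReal

noncomputable section

namespace EFM

/-- Points `ξ = (t, c)` with `t ∈ ℝ` the generation time and `c ∈ ℝᵖ` the condition. -/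
abbrev TimeCond (p : ℕ) : Type := ℝ × EuclideanSpace ℝ (Fin p)

/-- The cylinder `I × Ω`, `I = [0, 1]`. -/
abbrev cyl {p : ℕ} (Ω : Set (EuclideanSpace ℝ (Fin p))) : Set (TimeCond p) :=
  Icc (0 : ℝ) 1 ×ˢ Ω

/-- The Lebesgue measure `dt dc` on `I × Ω`. -/
def leb {p : ℕ} (Ω : Set (EuclideanSpace ℝ (Fin p))) : Measure (cyl Ω) :=
  Measure.comap Subtype.val volume

/-- The standard basis of `ℝ × ℝᵖ`: `dir 0` is the time direction, `dir (i + 1)` is the direction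
of the `i`-th coordinate of the condition. -/
def dir {p : ℕ} : Fin (p + 1) → TimeCond p :=
  Fin.cons ((1 : ℝ), 0) (fun i : Fin p => ((0 : ℝ), EuclideanSpace.single i (1 : ℝ)))

section

variable {p q : ℕ}

/-- `(q × (p + 1))`-matrices, as the family of their `p + 1` columns in `ℝ^q`. -/
abbrev Columns (p q : ℕ) : Type := Fin (p + 1) → EuclideanSpace ℝ (Fin q)

/-- The squared Euclidean (Frobenius) norm `|A|²` of a `(q × (p + 1))`-matrix. -/
def normSq (A : Columns p q) : ℝ≥0∞ := ∑ i, ‖A i‖ₑ ^ 2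

variable (Ω : Set (EuclideanSpace ℝ (Fin p))) (D : Set (EuclideanSpace ℝ (Fin q)))

/-! ### The generalized continuity equation and the Dirichlet energy -/

/-- The kinetic energy `∫_{I × Ω} ∫_D |v(ξ, x)|² dμ_ξ(x) dξ`, without the factor `1/2`. -/
def kineticEnergy (μ : cyl Ω → ProbabilityMeasure D) (v : cyl Ω × D → Columns p q) : ℝ≥0∞ :=
  ∫⁻ ξ : cyl Ω, ∫⁻ x : D, normSq (v (ξ, x)) ∂(μ ξ : Measure D) ∂(leb Ω)

/-- `(μ, v)` is a distributional solution of `∇_ξ μ + div_x (μ v) = 0` on `I × Ω`.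
The measurable structure on `ProbabilityMeasure D` is the one generated by the evaluations
`ν ↦ ν A`, which for `D ⊆ ℝ^q` is the Borel σ-algebra of the narrow topology. The test functions
are compactly supported in `(0, 1) × Ω × ℝ^q`, the interior of `I × Ω` times `ℝ^q` (`Ω` open).
The `i`-th summand is `∂_{ξ^i} φ^i + ⟨∇_x φ^i, v^i⟩`, where `v^i` is the `i`-th column of `v`. -/
def IsSolution (μ : cyl Ω → ProbabilityMeasure D) (v : cyl Ω × D → Columns p q) : Prop :=
  Measurable μ ∧ Measurable v ∧ kineticEnergy Ω D μ v < ⊤ ∧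
    ∀ φ : TimeCond p × EuclideanSpace ℝ (Fin q) → (Fin (p + 1) → ℝ),
      ContDiff ℝ (⊤ : ℕ∞) φ → HasCompactSupport φ → tsupport φ ⊆ interior (cyl Ω) ×ˢ univ →
        ∫ ξ : cyl Ω, ∫ x : D,
          ∑ i, (fderiv ℝ φ ((ξ : TimeCond p), (x : EuclideanSpace ℝ (Fin q))) (dir i, 0) i
            + fderiv ℝ φ ((ξ : TimeCond p), (x : EuclideanSpace ℝ (Fin q))) (0, v (ξ, x) i) i)
          ∂(μ ξ : Measure D) ∂(leb Ω) = 0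

/-- The Dirichlet energy `Dir_{I × Ω}(μ)`: the infimum of `½ ∬ |v|² dμ_ξ dξ` over all `v` such that
`(μ, v)` solves the generalized continuity equation (`∞` if there is no such `v`). -/
def dirichletEnergy (μ : cyl Ω → ProbabilityMeasure D) : ℝ≥0∞ :=
  ⨅ (v : cyl Ω × D → Columns p q) (_ : IsSolution Ω D μ v), 2⁻¹ * kineticEnergy Ω D μ v

/-! ### Differentiable maps `I × Ω → D` -/

/-- Extension by zero of a map `I × Ω → D` to `ℝ × ℝᵖ`; the derivatives within `I × Ω` taken below
do not depend on the values outside of `I × Ω`. -/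
def extend (ψ : cyl Ω → D) : TimeCond p → EuclideanSpace ℝ (Fin q) :=
  Function.extend Subtype.val (fun ξ => (ψ ξ : EuclideanSpace ℝ (Fin q))) 0

/-- The space of differentiable maps `ψ : I × Ω → D` (one-sidedly in `t` at `t = 0, 1`), with the
σ-algebra generated by the evaluations `ψ ↦ ψ(t, c)`. -/
abbrev DiffMap : Type :=
  {ψ : cyl Ω → D // DifferentiableOn ℝ (extend Ω D ψ) (cyl Ω)}

variable {Ω D}

/-- The Jacobian matrix `∇_{t,c} ψ(t, c)`. -/
def DiffMap.grad (ψ : DiffMap Ω D) (ξ : cyl Ω) : Columns p q :=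
  fun i => fderivWithin ℝ (extend Ω D ψ.1) (cyl Ω) (ξ : TimeCond p) (dir i)

/-- Evaluation at a point is measurable. -/
theorem DiffMap.measurable_eval (ξ : cyl Ω) : Measurable fun ψ : DiffMap Ω D => ψ.1 ξ :=
  (measurable_pi_apply ξ).comp measurable_subtype_coe

/-- `μ_{t,c} = E_{ψ ∼ Q} [δ_{ψ(t,c)}]`. -/
def mixture (Q : Measure (DiffMap Ω D)) [IsProbabilityMeasure Q] (ξ : cyl Ω) :
    ProbabilityMeasure D :=
  ⟨Q.bind fun ψ => Measure.dirac (ψ.1 ξ),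
    isProbabilityMeasure_bind
      (Measure.measurable_dirac.comp (DiffMap.measurable_eval ξ)).aemeasurable
      (Filter.Eventually.of_forall fun _ => inferInstance)⟩

/-! ### The Sobolev space `H¹(I × Ω; D)` -/

/-- `g` is the weak partial derivative of `u` on (the interior of) `I × Ω` in direction `dir i`. -/
def IsWeakPartial (i : Fin (p + 1)) (u g : cyl Ω → EuclideanSpace ℝ (Fin q)) : Prop :=
  ∀ φ : TimeCond p → ℝ, ContDiff ℝ (⊤ : ℕ∞) φ → HasCompactSupport φ → tsupport φ ⊆ interior (cyl Ω) →
    ∫ ξ : cyl Ω, fderiv ℝ φ (ξ : TimeCond p) (dir i) • u ξ ∂(leb Ω)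
      = -∫ ξ : cyl Ω, φ (ξ : TimeCond p) • g ξ ∂(leb Ω)

variable (Ω D)

/-- The Sobolev space `H¹(I × Ω; D)`: the classes `u ∈ L²(I × Ω; ℝ^q)` with values in `D` almost
everywhere that have weak partial derivatives in `L²`. An element is stored as the pair of `u` and
its weak gradient, which `u` determines uniquely. -/
def SobolevMap : Type :=
  {w : Lp (EuclideanSpace ℝ (Fin q)) 2 (leb Ω)
      × (Fin (p + 1) → Lp (EuclideanSpace ℝ (Fin q)) 2 (leb Ω)) //
    (∀ᵐ ξ ∂(leb Ω), w.1 ξ ∈ D) ∧ ∀ i, IsWeakPartial i w.1 (w.2 i)}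

/-- The topology of the `H¹`-norm. -/
instance : TopologicalSpace (SobolevMap Ω D) :=
  TopologicalSpace.induced Subtype.val inferInstance

instance : MeasurableSpace (SobolevMap Ω D) := borel _

instance : BorelSpace (SobolevMap Ω D) := ⟨rfl⟩

variable {Ω D}

/-- A representative of the class `ψ ∈ H¹(I × Ω; D)`. -/
def SobolevMap.val (ψ : SobolevMap Ω D) (ξ : cyl Ω) : EuclideanSpace ℝ (Fin q) := ψ.1.1 ξ

/-- The weak gradient `∇_{t,c} ψ`. -/
def SobolevMap.grad (ψ : SobolevMap Ω D) (ξ : cyl Ω) : Columns p q := fun i => ψ.1.2 i ξ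

/-- `μ_{t,c} = E_{ψ ∼ Q} [δ_{ψ(t,c)}]` for almost every `(t, c)`, where `Q` is a distribution on
`H¹(I × Ω; D)`. As `ψ` is only defined almost everywhere, this is stated as the equality
`μ_ξ(dx) dξ = E_{ψ ∼ Q} [δ_{ψ(ξ)}(dx) dξ]` of measures on `(I × Ω) × ℝ^q`. -/
def IsSobolevMixture (Q : Measure (SobolevMap Ω D)) (μ : cyl Ω → ProbabilityMeasure D) : Prop :=
  Measurable μ ∧ ∀ A : Set (cyl Ω × EuclideanSpace ℝ (Fin q)), MeasurableSet A →
    ∫⁻ ξ : cyl Ω, (μ ξ : Measure D) {x : D | (ξ, (x : EuclideanSpace ℝ (Fin q))) ∈ A} ∂(leb Ω)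
      = ∫⁻ ψ, ∫⁻ ξ : cyl Ω,
          Measure.dirac (ψ.val ξ) {x : EuclideanSpace ℝ (Fin q) | (ξ, x) ∈ A} ∂(leb Ω) ∂Q

end

end EFM

end

noncomputable section

namespace EFM

open Filter Topology ContinuousLinearMap ProbabilityTheory
open scoped Convolution InnerProductSpace

/-! Put `P = Q ⊗ dξ` on pairs `(ψ, ξ)` and `T (ψ, ξ) = (ξ, ψ ξ)`. The law of `T` is `μ_ξ(dx) dξ`,
and the velocity field is the conditional expectation `v = E[∇ψ | T]`, a function of `(ξ, x)`. For a
single map, `∫ ∂_i [Φ (ξ, ψ ξ)] dξ = 0` for every test function `Φ`. By the chain rule this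
integrand is affine in `∇ψ`, with coefficients depending only on `T`. So after averaging over `Q`
the gradient may be replaced by `v`, and the outcome is the continuity equation. Conditional
expectation contracts `L²`, which bounds the energy of `v` by the mean energy of `ψ`. The argument
is `dirichletEnergy_le_of_random_map`, with `condMean` as the conditional expectation.

Both claims reduce to it once the chain rule and joint measurability in `(ψ, ξ)` are known. For
differentiable maps these come from integration by parts without continuity of the derivative
(`integral_chain_eq_zero_of_differentiableAt`) and from difference quotients. For Sobolev maps they
come from mollification (`HasWeakDerivOn.integral_chain_eq_zero`) and from a measurable choice of
representatives (`exists_measurable_representative`). -/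

theorem integrable_clm_apply_of_bound {X G : Type*} [MeasurableSpace X] {R : Measure X}
    [NormedAddCommGroup G] [NormedSpace ℝ G] {A : X → G →L[ℝ] ℝ}
    (hA : AEStronglyMeasurable A R) {C : ℝ} (hC : ∀ x, ‖A x‖ ≤ C) {h : X → G}
    (hh : Integrable h R) :
    Integrable (fun x => A x (h x)) R := by
  refine (hh.norm.const_mul C).mono' ?_ (Eventually.of_forall fun x => ?_)
  · exact (ContinuousLinearMap.apply ℝ ℝ).flip.aestronglyMeasurable_comp₂ hA hh.1
  · exact (ContinuousLinearMap.le_opNorm _ _).trans (by gcongr; exact hC _)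

/-! ### Integration by parts and the chain rule for differentiable maps -/

section Analysis

variable {E F : Type*} [NormedAddCommGroup E] [NormedSpace ℝ E] [NormedAddCommGroup F]

/-- A Scheffé-type argument: `‖f n - g‖ - ‖f n‖` is dominated by `‖g‖` and tends to `-‖g‖` almost
everywhere, while the masses of `f n` never exceed that of `g`. -/
theorem tendsto_integral_norm_sub {α : Type*} [MeasurableSpace α] {μ : Measure α}
    {f : ℕ → α → F} {g : α → F} (hf : ∀ n, Integrable (f n) μ) (hg : Integrable g μ)
    (hlim : ∀ᵐ x ∂μ, Tendsto (fun n => f n x) atTop (𝓝 (g x)))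
    (hle : ∀ n, ∫ x, ‖f n x‖ ∂μ ≤ ∫ x, ‖g x‖ ∂μ) :
    Tendsto (fun n => ∫ x, ‖f n x - g x‖ ∂μ) atTop (𝓝 0) := by
  have key : Tendsto (fun n => ∫ x, (‖f n x - g x‖ - ‖f n x‖) ∂μ) atTop
      (𝓝 (∫ x, (‖g x - g x‖ - ‖g x‖) ∂μ)) := by
    refine tendsto_integral_of_dominated_convergence (fun x => ‖g x‖)
      (fun n => ((hf n).sub hg).norm.aestronglyMeasurable.sub (hf n).norm.aestronglyMeasurable)
      hg.norm (fun n => Eventually.of_forall fun x => ?_) ?_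
    · have := abs_norm_sub_norm_le (f n x - g x) (f n x)
      simpa using this
    · filter_upwards [hlim] with x hx
      exact (hx.sub_const _).norm.sub hx.norm
  have key' := key.add_const (∫ x, ‖g x‖ ∂μ)
  simp only [sub_self, norm_zero, zero_sub, integral_neg, neg_add_cancel] at key'
  refine squeeze_zero (fun n => integral_nonneg fun x => norm_nonneg _) (fun n => ?_) key'
  have := integral_sub (f := fun x => ‖f n x - g x‖) ((hf n).sub hg).norm (hf n).norm
  linarith [hle n]

variable [NormedSpace ℝ F]

/-- The projection to the base of the support of a test function on `E × F`. -/
theorem eq_zero_of_notMem_fst_tsupport {G : Type*} [NormedAddCommGroup G] [NormedSpace ℝ G]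
    {Φ : E × F → G} {ξ : E}
    (h : ξ ∉ Prod.fst '' tsupport Φ) (x : F) : Φ (ξ, x) = 0 ∧ fderiv ℝ Φ (ξ, x) = 0 := by
  have hx : (ξ, x) ∉ tsupport Φ := fun hx => h ⟨_, hx, rfl⟩
  refine ⟨image_eq_zero_of_notMem_tsupport hx, image_eq_zero_of_notMem_tsupport fun h' => hx ?_⟩
  exact tsupport_fderiv_subset ℝ h'

variable [FiniteDimensional ℝ E] [MeasurableSpace E] [BorelSpace E] {m : Measure E}

/-- Integrability of `h` is needed only over the compact shadow of the support, so that `h` may have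
a constant component, which need not be integrable on all of `E`. -/
theorem integrable_fderiv_apply [FiniteDimensional ℝ F] {Φ : E × F → ℝ} (hΦ : ContDiff ℝ 1 Φ)
    (hΦc : HasCompactSupport Φ) {w : E → F} (hw : AEStronglyMeasurable w m) {h : E → E × F}
    (hh : IntegrableOn h (Prod.fst '' tsupport Φ) m) :
    Integrable (fun ξ => fderiv ℝ Φ (ξ, w ξ) (h ξ)) m := by
  have hcont : Continuous (fderiv ℝ Φ) := hΦ.continuous_fderiv one_ne_zero
  obtain ⟨C, hC⟩ := (hΦc.fderiv ℝ).exists_bound_of_continuous hcont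
  rw [← integrableOn_iff_integrable_of_support_subset (s := Prod.fst '' tsupport Φ)]
  · have hm : AEStronglyMeasurable (fun ξ => fderiv ℝ Φ (ξ, w ξ)) m :=
      hcont.comp_aestronglyMeasurable (aestronglyMeasurable_id.prodMk hw)
    exact integrable_clm_apply_of_bound hm.restrict (fun _ => hC _) hh
  · intro ξ hξ
    by_contra hn
    exact hξ (by simp [(eq_zero_of_notMem_fst_tsupport hn (w ξ)).2])

variable [m.IsAddHaarMeasure]

/-- Integration by parts against the constant function `1`. It needs differentiability everywhere
and integrability, but no continuity of the derivative. -/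
theorem integral_fderiv_apply_eq_zero {f : E → ℝ} {v : E} (hf : Differentiable ℝ f)
    (hfi : Integrable f m) (hf' : Integrable (fun x => fderiv ℝ f x v) m) :
    ∫ x, fderiv ℝ f x v ∂m = 0 := by
  have := integral_mul_fderiv_eq_neg_fderiv_mul_of_integrable (μ := m) (f := fun _ : E => (1 : ℝ))
    (g := f) (v := v) (by simp) (by simpa using hf') (by simpa using hfi)
    (fun x _ => by fun_prop) (fun x _ => hf x)
  simpa using this

theorem integral_chain_eq_zero_of_differentiableAt {Φ : E × F → ℝ} (hΦ : ContDiff ℝ 1 Φ)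
    (hΦc : HasCompactSupport Φ) {w : E → F}
    (hw : ∀ ξ ∈ Prod.fst '' tsupport Φ, DifferentiableAt ℝ w ξ) {v : E}
    (hi : Integrable (fun ξ => fderiv ℝ Φ (ξ, w ξ) (v, fderiv ℝ w ξ v)) m) :
    ∫ ξ, fderiv ℝ Φ (ξ, w ξ) (v, fderiv ℝ w ξ v) ∂m = 0 := by
  have hK : IsCompact (Prod.fst '' tsupport Φ) := hΦc.isCompact.image continuous_fst
  have hd : ∀ ξ, HasFDerivAt (fun ξ => Φ (ξ, w ξ))
      (fderiv ℝ Φ (ξ, w ξ) ∘L (ContinuousLinearMap.id ℝ E).prod (fderiv ℝ w ξ)) ξ := by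
    intro ξ
    by_cases hξ : ξ ∈ Prod.fst '' tsupport Φ
    · exact (hΦ.differentiable one_ne_zero (ξ, w ξ)).hasFDerivAt.comp ξ
        ((hasFDerivAt_id ξ).prodMk (hw ξ hξ).hasFDerivAt)
    -- Off the shadow of the support `w` may be irregular, but the composition vanishes in a whole
    -- neighbourhood.
    · rw [(eq_zero_of_notMem_fst_tsupport hξ (w ξ)).2, ContinuousLinearMap.zero_comp]
      refine (hasFDerivAt_const (0 : ℝ) ξ).congr_of_eventuallyEq ?_
      filter_upwards [hK.isClosed.isOpen_compl.mem_nhds hξ] with y hy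
      exact (eq_zero_of_notMem_fst_tsupport hy (w y)).1
  have heq : (fun ξ => fderiv ℝ Φ (ξ, w ξ) (v, fderiv ℝ w ξ v))
      = fun ξ => fderiv ℝ (fun ξ => Φ (ξ, w ξ)) ξ v := by
    funext ξ
    rw [(hd ξ).fderiv]
    simp
  rw [heq] at hi ⊢
  refine integral_fderiv_apply_eq_zero (fun ξ => (hd ξ).differentiableAt) ?_ hi
  have hc : Continuous (fun ξ => Φ (ξ, w ξ)) :=
    continuous_iff_continuousAt.2 fun ξ => (hd ξ).continuousAt
  refine hc.integrable_of_hasCompactSupport (HasCompactSupport.intro hK fun ξ hξ => ?_)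
  exact (eq_zero_of_notMem_fst_tsupport hξ (w ξ)).1

end Analysis

/-! ### Mollification and the chain rule for weak derivatives -/

section Mollification

variable {E F : Type*} [NormedAddCommGroup E] [NormedSpace ℝ E] [FiniteDimensional ℝ E]
  [MeasurableSpace E] [BorelSpace E] {m : Measure E} [m.IsAddHaarMeasure]
  [NormedAddCommGroup F] [NormedSpace ℝ F]

theorem fderiv_convolution_apply {ρ : E → ℝ} (hρ : ContDiff ℝ 1 ρ) (hρc : HasCompactSupport ρ)
    {u : E → F} (hu : LocallyIntegrable u m) (x v : E) :
    fderiv ℝ (ρ ⋆[lsmul ℝ ℝ, m] u) x v = ∫ t, fderiv ℝ ρ (x - t) v • u t ∂m := by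
  rw [(hρc.hasFDerivAt_convolution_left (lsmul ℝ ℝ) hρ hu x).fderiv, convolution_eq_swap,
    ContinuousLinearMap.integral_apply]
  · rfl
  · exact ((hρc.fderiv ℝ).convolutionExists_left _ (hρ.continuous_fderiv one_ne_zero)
      hu x).integrable_swap

/-- `g` is the weak derivative of `u` in the direction `v` on `U`. -/
def HasWeakDerivOn (m : Measure E) (U : Set E) (v : E) (u g : E → F) : Prop :=
  ∀ φ : E → ℝ, ContDiff ℝ (⊤ : ℕ∞) φ → HasCompactSupport φ → tsupport φ ⊆ U →
    ∫ ξ, fderiv ℝ φ ξ v • u ξ ∂m = -∫ ξ, φ ξ • g ξ ∂m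

/-- The reflected bump `t ↦ ρ (x - t)` is an admissible test function because its support lies in
the closed ball; the sign from the reflection cancels the one in the weak derivative. -/
theorem HasWeakDerivOn.fderiv_convolution {U : Set E} {v : E} {u g : E → F}
    (h : HasWeakDerivOn m U v u g) (hu : LocallyIntegrable u m)
    (ρ : ContDiffBump (0 : E)) {x : E} (hx : Metric.closedBall x ρ.rOut ⊆ U) :
    fderiv ℝ (ρ.normed m ⋆[lsmul ℝ ℝ, m] u) x v = (ρ.normed m ⋆[lsmul ℝ ℝ, m] g) x := by
  have hd : ContDiff ℝ (⊤ : ℕ∞) (ρ.normed m) := ρ.contDiff_normed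
  have h1 : ContDiff ℝ (⊤ : ℕ∞) (fun t => ρ.normed m (x - t)) :=
    hd.comp (contDiff_const.sub contDiff_id)
  have hts : tsupport (fun t => ρ.normed m (x - t)) ⊆ Metric.closedBall x ρ.rOut := by
    refine closure_minimal (fun t ht => ?_) Metric.isClosed_closedBall
    have : x - t ∈ Function.support (ρ.normed m) := ht
    rw [ρ.support_normed_eq, mem_ball_zero_iff] at this
    rw [Metric.mem_closedBall, dist_comm, dist_eq_norm]
    exact this.le
  have hc : HasCompactSupport (fun t => ρ.normed m (x - t)) :=
    (isCompact_closedBall x ρ.rOut).of_isClosed_subset (isClosed_tsupport _) hts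
  have hder : ∀ t, fderiv ℝ (fun t => ρ.normed m (x - t)) t v
      = -fderiv ℝ (ρ.normed m) (x - t) v := by
    intro t
    have : HasFDerivAt (fun t => ρ.normed m (x - t)) _ t :=
      ((hd.differentiable (by simp)) (x - t)).hasFDerivAt.comp t
      ((hasFDerivAt_id t).const_sub x)
    rw [this.fderiv]
    simp
  have := h _ h1 hc (hts.trans hx)
  simp only [hder, neg_smul, integral_neg, neg_inj] at this
  rw [fderiv_convolution_apply (hd.of_le (by simp)) ρ.hasCompactSupport_normed hu, this,
    convolution_lsmul_swap]

/-- Young's inequality for a kernel of mass one: the norm of the convolution is at most the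
convolution of the norms. -/
theorem integral_norm_normed_convolution_le (ρ : ContDiffBump (0 : E)) {g : E → F}
    (hg : Integrable g m) :
    ∫ x, ‖(ρ.normed m ⋆[lsmul ℝ ℝ, m] g) x‖ ∂m ≤ ∫ x, ‖g x‖ ∂m := by
  have hρ : Integrable (ρ.normed m) m := ρ.integrable_normed
  have h := integral_convolution (lsmul ℝ ℝ) hρ hg.norm (μ := m) (ν := m)
  rw [ρ.integral_normed, lsmul_apply, one_smul] at h
  rw [← h]
  refine integral_mono (hρ.integrable_convolution _ hg).norm
    (hρ.integrable_convolution _ hg.norm) fun x => ?_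
  simp only [convolution_def, lsmul_apply]
  refine (norm_integral_le_integral_norm _).trans_eq ?_
  congr 1 with t
  rw [norm_smul, Real.norm_of_nonneg (ρ.nonneg_normed _), smul_eq_mul]

variable [FiniteDimensional ℝ F]

/-- The chain rule for compositions `ξ ↦ Φ (ξ, u ξ)` of a test function with a Sobolev map. -/
theorem HasWeakDerivOn.integral_chain_eq_zero {U : Set E} (hU : IsOpen U) {v : E} {u g : E → F}
    (h : HasWeakDerivOn m U v u g) (hu : Integrable u m) (hg : Integrable g m)
    {Φ : E × F → ℝ} (hΦ : ContDiff ℝ 1 Φ) (hΦc : HasCompactSupport Φ)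
    (hΦU : tsupport Φ ⊆ U ×ˢ univ) :
    ∫ ξ, fderiv ℝ Φ (ξ, u ξ) (v, g ξ) ∂m = 0 := by
  have hK : IsCompact (Prod.fst '' tsupport Φ) := hΦc.isCompact.image continuous_fst
  have hKU : Prod.fst '' tsupport Φ ⊆ U := by
    rintro _ ⟨z, hz, rfl⟩
    exact (hΦU hz).1
  obtain ⟨δ, hδ, hδU⟩ := hK.exists_cthickening_subset_open hU hKU
  -- The outer radii tend to zero and stay below `δ`; the fixed ratio `2` to the inner radii gives
  -- almost everywhere convergence of the mollifications.
  let ρ : ℕ → ContDiffBump (0 : E) := fun n =>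
    ⟨δ / (n + 2) / 2, δ / (n + 2), by positivity, half_lt_self (by positivity)⟩
  have hρ0 : Tendsto (fun n => (ρ n).rOut) atTop (𝓝 0) :=
    tendsto_const_nhds.div_atTop (tendsto_atTop_add_const_right _ _ tendsto_natCast_atTop_atTop)
  have hρK : ∀ᶠ n in atTop, (ρ n).rOut ≤ 2 * (ρ n).rIn :=
    Eventually.of_forall fun n => by simp only [ρ]; linarith
  have hρδ : ∀ n, (ρ n).rOut ≤ δ := fun n =>
    div_le_self hδ.le (by have : (0 : ℝ) ≤ n := n.cast_nonneg; linarith)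
  let un : ℕ → E → F := fun n => (ρ n).normed m ⋆[lsmul ℝ ℝ, m] u
  let gn : ℕ → E → F := fun n => (ρ n).normed m ⋆[lsmul ℝ ℝ, m] g
  have hun : ∀ᵐ ξ ∂m, Tendsto (fun n => un n ξ) atTop (𝓝 (u ξ)) :=
    ContDiffBump.ae_convolution_tendsto_right_of_locallyIntegrable hρ0 hρK hu.locallyIntegrable
  have hgn : ∀ᵐ ξ ∂m, Tendsto (fun n => gn n ξ) atTop (𝓝 (g ξ)) :=
    ContDiffBump.ae_convolution_tendsto_right_of_locallyIntegrable hρ0 hρK hg.locallyIntegrable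
  have hgi : ∀ n, Integrable (gn n) m := fun n =>
    (ρ n).integrable_normed.integrable_convolution _ hg
  have hgL : Tendsto (fun n => ∫ ξ, ‖gn n ξ - g ξ‖ ∂m) atTop (𝓝 0) :=
    tendsto_integral_norm_sub hgi hg hgn fun n => integral_norm_normed_convolution_le _ hg
  have hud : ∀ n, ContDiff ℝ 1 (un n) := fun n =>
    (ρ n).hasCompactSupport_normed.contDiff_convolution_left _ (n := 1) (ρ n).contDiff_normed
      hu.locallyIntegrable
  have hum : ∀ n, AEStronglyMeasurable (un n) m := fun n =>
    (hud n).continuous.aestronglyMeasurable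
  have hpair : ∀ {k : E → F}, Integrable k m →
      IntegrableOn (fun ξ => (v, k ξ)) (Prod.fst '' tsupport Φ) m := fun hk =>
    Integrable.prodMk (integrableOn_const (C := v) hK.measure_lt_top.ne (by simp)) hk.integrableOn
  have hint : ∀ {w k : E → F}, AEStronglyMeasurable w m → Integrable k m →
      Integrable (fun ξ => fderiv ℝ Φ (ξ, w ξ) (v, k ξ)) m := fun hw hk =>
    integrable_fderiv_apply hΦ hΦc hw (hpair hk)
  -- Over the shadow of the support the mollifying balls stay in `U`, so there `gn n` is the
  -- classical derivative of `un n`.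
  have hchain : ∀ n, ∫ ξ, fderiv ℝ Φ (ξ, un n ξ) (v, gn n ξ) ∂m = 0 := by
    intro n
    have heq : (fun ξ => fderiv ℝ Φ (ξ, un n ξ) (v, gn n ξ))
        = fun ξ => fderiv ℝ Φ (ξ, un n ξ) (v, fderiv ℝ (un n) ξ v) := by
      funext ξ
      by_cases hξ : ξ ∈ Prod.fst '' tsupport Φ
      · rw [h.fderiv_convolution hu.locallyIntegrable (ρ n)]
        exact ((Metric.closedBall_subset_closedBall (hρδ n)).trans
          (Metric.closedBall_subset_cthickening hξ δ)).trans hδU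
      · simp [(eq_zero_of_notMem_fst_tsupport hξ (un n ξ)).2]
    have hi := hint (hum n) (hgi n)
    rw [heq] at hi ⊢
    exact integral_chain_eq_zero_of_differentiableAt hΦ hΦc
      (fun ξ _ => (hud n).differentiable one_ne_zero ξ) hi
  have hcont : Continuous (fderiv ℝ Φ) := hΦ.continuous_fderiv one_ne_zero
  obtain ⟨C, hC⟩ := (hΦc.fderiv ℝ).exists_bound_of_continuous hcont
  -- Mixed integrals, with `un n` but the limiting `g`, separate the two convergences: dominated
  -- convergence handles `un n`, and the `L¹` error of `gn n` handles the gradient.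
  have hlim1 : Tendsto (fun n => ∫ ξ, fderiv ℝ Φ (ξ, un n ξ) (v, g ξ) ∂m) atTop
      (𝓝 (∫ ξ, fderiv ℝ Φ (ξ, u ξ) (v, g ξ) ∂m)) := by
    refine tendsto_integral_of_dominated_convergence
      ((Prod.fst '' tsupport Φ).indicator fun ξ => C * ‖((v, g ξ) : E × F)‖)
      (fun n => (hint (hum n) hg).aestronglyMeasurable) ?_ (fun n => ?_) ?_
    · exact IntegrableOn.integrable_indicator ((hpair hg).norm.const_mul C) hK.measurableSet
    · refine Eventually.of_forall fun ξ => ?_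
      by_cases hξ : ξ ∈ Prod.fst '' tsupport Φ
      · rw [indicator_of_mem hξ]
        exact (le_opNorm _ _).trans (by gcongr; exact hC _)
      · rw [indicator_of_notMem hξ]
        simp [(eq_zero_of_notMem_fst_tsupport hξ (un n ξ)).2]
    · filter_upwards [hun] with ξ hξ
      have : Tendsto (fun n => fderiv ℝ Φ (ξ, un n ξ)) atTop (𝓝 (fderiv ℝ Φ (ξ, u ξ))) :=
        (hcont.tendsto (ξ, u ξ)).comp (tendsto_const_nhds.prodMk_nhds hξ)
      exact ((ContinuousLinearMap.apply ℝ ℝ ((v, g ξ) : E × F)).continuous.tendsto _).comp this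
  have hlim2 : Tendsto (fun n => ∫ ξ, fderiv ℝ Φ (ξ, un n ξ) (v, g ξ) ∂m) atTop (𝓝 0) := by
    refine squeeze_zero_norm (fun n => ?_) (by simpa using hgL.const_mul C)
    rw [← sub_zero (∫ ξ, fderiv ℝ Φ (ξ, un n ξ) (v, g ξ) ∂m), ← hchain n,
      ← integral_sub (hint (hum n) hg) (hint (hum n) (hgi n)), ← integral_const_mul]
    refine norm_integral_le_of_norm_le (((hgi n).sub hg).norm.const_mul C)
      (Eventually.of_forall fun ξ => ?_)
    rw [← map_sub, Prod.mk_sub_mk, sub_self]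
    refine (le_opNorm _ _).trans ?_
    rw [Prod.norm_mk, norm_zero, max_eq_right (norm_nonneg _), norm_sub_rev]
    gcongr
    exact hC _
  exact tendsto_nhds_unique hlim1 hlim2

end Mollification

/-! ### Conditional expectation as an adjoint in `L²` -/

section Projection

variable {X Z F : Type*} [MeasurableSpace X] [MeasurableSpace Z] {P : Measure X} {ν : Measure Z}
  [NormedAddCommGroup F]

theorem lintegral_enorm_sq_Lp (f : Lp F 2 P) : ∫⁻ x, ‖f x‖ₑ ^ 2 ∂P = ‖f‖ₑ ^ 2 := by
  have := eLpNorm_nnreal_pow_eq_lintegral (f := f) (μ := P) (p := 2) two_ne_zero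
  rw [Lp.enorm_def]
  simpa using this.symm

theorem memLp_two_of_lintegral_ne_top {g : X → F} (hg : AEStronglyMeasurable g P)
    (h : ∫⁻ x, ‖g x‖ₑ ^ 2 ∂P ≠ ⊤) : MemLp g 2 P := by
  refine ⟨hg, ?_⟩
  have := eLpNorm_nnreal_pow_eq_lintegral (f := g) (μ := P) (p := 2) two_ne_zero
  simp only [NNReal.coe_ofNat, ENNReal.rpow_ofNat, ENNReal.coe_ofNat] at this
  rw [← this] at h
  exact lt_top_iff_ne_top.2 fun h' => h (by simp [h'])

variable [InnerProductSpace ℝ F] [CompleteSpace F]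

/-- The conditional expectation `E[g | T = z]` as a function of `z`: the adjoint of the isometry
`w ↦ w ∘ T` of `L²` spaces. -/
def condMean {T : X → Z} (hT : MeasurePreserving T P ν) (g : Lp F 2 P) : Lp F 2 ν :=
  ContinuousLinearMap.adjoint
    (Lp.compMeasurePreservingₗᵢ (E := F) (p := 2) ℝ T hT).toContinuousLinearMap g

/-- The adjoint of an isometry has norm at most one; this replaces Jensen's inequality. -/
theorem enorm_condMean_le {T : X → Z} (hT : MeasurePreserving T P ν) (g : Lp F 2 P) :
    ‖condMean hT g‖ₑ ≤ ‖g‖ₑ := by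
  have h : ‖condMean hT g‖ ≤ 1 * ‖g‖ := by
    refine le_of_opNorm_le _ ?_ g
    rw [LinearIsometryEquiv.norm_map]
    exact LinearIsometry.norm_toContinuousLinearMap_le _
  rw [one_mul] at h
  exact enorm_le_iff_norm_le.2 h

/-- By Riesz, `L z` is the inner product with a bounded field `W z`, which lies in `L²` as `ν` is
finite. The identity is then the definition of the adjoint, tested with `W`. -/
theorem integral_apply_condMean [IsFiniteMeasure P] {T : X → Z} (hT : MeasurePreserving T P ν)
    (g : Lp F 2 P) {L : Z → F →L[ℝ] ℝ} (hL : StronglyMeasurable L) {C : ℝ} (hC : ∀ z, ‖L z‖ ≤ C) :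
    ∫ z, L z (condMean hT g z) ∂ν = ∫ x, L (T x) (g x) ∂P := by
  have : IsFiniteMeasure ν := by
    rw [← hT.map_eq]
    infer_instance
  let W : Z → F := fun z => (InnerProductSpace.toDual ℝ F).symm (L z)
  have hW : MemLp W 2 ν := by
    refine MemLp.of_bound ?_ C (Eventually.of_forall fun z => ?_)
    · exact ((InnerProductSpace.toDual ℝ F).symm.continuous.comp_stronglyMeasurable
        hL).aestronglyMeasurable
    · simpa [W] using hC z
  have hin : ∀ z f, ⟪W z, f⟫_ℝ = L z f := fun z f => by simp [W]
  have h := ContinuousLinearMap.adjoint_inner_right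
    (Lp.compMeasurePreservingₗᵢ (E := F) (p := 2) ℝ T hT).toContinuousLinearMap (hW.toLp W) g
  rw [L2.inner_def, L2.inner_def] at h
  calc ∫ z, L z (condMean hT g z) ∂ν
      = ∫ z, ⟪hW.toLp W z, condMean hT g z⟫_ℝ ∂ν := by
        refine integral_congr_ae ?_
        filter_upwards [hW.coeFn_toLp] with z hz
        rw [hz, hin]
    _ = _ := h
    _ = ∫ x, L (T x) (g x) ∂P := by
        refine integral_congr_ae ?_
        filter_upwards [Lp.coeFn_compMeasurePreserving (hW.toLp W) hT,
          hT.quasiMeasurePreserving.ae hW.coeFn_toLp] with x hx hx'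
        rw [← hin, ← hx']
        exact congrArg (fun a => ⟪a, g x⟫_ℝ) hx

end Projection

/-! ### From a random map to a solution of the continuity equation -/

section Representation

variable {p q : ℕ} {Ω : Set (EuclideanSpace ℝ (Fin p))} {D : Set (EuclideanSpace ℝ (Fin q))}

/-- The chain rule tested against compactly supported functions: `g` plays the role of the gradient
of `u` in the identity `∫ ∇_ξ [Φ (ξ, u ξ)] dξ = 0`. -/
def SatisfiesChainRule (u : cyl Ω → EuclideanSpace ℝ (Fin q)) (g : cyl Ω → Columns p q) : Prop :=
  ∀ (i : Fin (p + 1)) (Φ : TimeCond p × EuclideanSpace ℝ (Fin q) → ℝ),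
    ContDiff ℝ (⊤ : ℕ∞) Φ → HasCompactSupport Φ → tsupport Φ ⊆ interior (cyl Ω) ×ˢ univ →
      ∫ ξ : cyl Ω, fderiv ℝ Φ ((ξ : TimeCond p), u ξ) (dir i, g ξ i) ∂(leb Ω) = 0

theorem measurable_normSq : Measurable (normSq : Columns p q → ℝ≥0∞) := by
  unfold normSq
  fun_prop

/-- The Markov kernel of a measurable family of probability measures. -/
def toKernel {μ : cyl Ω → ProbabilityMeasure D} (hμ : Measurable μ) : Kernel (cyl Ω) D :=
  ⟨fun ξ => (μ ξ : Measure D), measurable_subtype_coe.comp hμ⟩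

instance {μ : cyl Ω → ProbabilityMeasure D} (hμ : Measurable μ) : IsMarkovKernel (toKernel hμ) :=
  ⟨fun ξ => inferInstanceAs (IsProbabilityMeasure (μ ξ : Measure D))⟩

/-- If `μ_ξ(dx) dξ` is the law of `(ξ, u)` for a random map `u` on `I × Ω` that satisfies the chain
rule with gradient `g`, then the Dirichlet energy of `μ` is at most the mean energy of `u`. -/
theorem dirichletEnergy_le_of_random_map {Y : Type*} [MeasurableSpace Y] (Q : Measure Y)
    [IsFiniteMeasure Q] [IsFiniteMeasure (leb Ω)] {μ : cyl Ω → ProbabilityMeasure D}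
    (hμ : Measurable μ) {u : Y × cyl Ω → EuclideanSpace ℝ (Fin q)} (hu : Measurable u)
    {g : Y × cyl Ω → Columns p q} (hg : Measurable g)
    (hfin : ∫⁻ z, normSq (g z) ∂(Q.prod (leb Ω)) ≠ ⊤)
    (hmap : ((leb Ω).compProd (toKernel hμ)).map (fun z => (z.1, (z.2 : EuclideanSpace ℝ (Fin q))))
      = (Q.prod (leb Ω)).map (fun z => (z.2, u z)))
    (hchain : ∀ᵐ y ∂Q, SatisfiesChainRule (fun ξ => u (y, ξ)) (fun ξ => g (y, ξ))) :
    dirichletEnergy Ω D μ ≤ ∫⁻ z, normSq (g z) ∂(Q.prod (leb Ω)) := by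
  set P := Q.prod (leb Ω) with hP
  set T : Y × cyl Ω → cyl Ω × EuclideanSpace ℝ (Fin q) := fun z => (z.2, u z)
  have hTm : Measurable T := measurable_snd.prodMk hu
  set ν := P.map T
  have hT : MeasurePreserving T P ν := ⟨hTm, rfl⟩
  set S : cyl Ω × D → cyl Ω × EuclideanSpace ℝ (Fin q) := fun z => (z.1, z.2)
  have hSm : Measurable S := measurable_fst.prodMk (measurable_subtype_coe.comp measurable_snd)
  have hgi : ∀ i, Measurable fun z => g z i := fun i => (measurable_pi_apply i).comp hg
  have hsum : ∫⁻ z, normSq (g z) ∂P = ∑ i, ∫⁻ z, ‖g z i‖ₑ ^ 2 ∂P :=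
    lintegral_finsetSum _ fun i _ => (hgi i).enorm.pow_const 2
  have hmem : ∀ i, MemLp (fun z => g z i) 2 P := fun i =>
    memLp_two_of_lintegral_ne_top (hgi i).aestronglyMeasurable
      (ne_top_of_le_ne_top (hsum ▸ hfin) (Finset.single_le_sum
        (f := fun i => ∫⁻ z, ‖g z i‖ₑ ^ 2 ∂P) (fun _ _ => zero_le) (Finset.mem_univ i)))
  -- The columns `E[g i | (ξ, u)]`, as functions on all of `ℝ^q` in `x`; `v` is their restriction to
  -- `D`.
  let w : ∀ _ : Fin (p + 1), Lp (EuclideanSpace ℝ (Fin q)) 2 ν :=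
    fun i => condMean hT ((hmem i).toLp _)
  have hwm : ∀ i, Measurable (w i) := fun i => (Lp.stronglyMeasurable (w i)).measurable
  let v : cyl Ω × D → Columns p q := fun z i => w i (S z)
  have hvm : Measurable v := measurable_pi_lambda _ fun i => (hwm i).comp hSm
  have hkin : kineticEnergy Ω D μ v ≤ ∫⁻ z, normSq (g z) ∂P := by
    have h1 : kineticEnergy Ω D μ v = ∫⁻ z, normSq (v z) ∂((leb Ω).compProd (toKernel hμ)) :=
      (Measure.lintegral_compProd (μ := leb Ω) (κ := toKernel hμ) (f := fun z => normSq (v z))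
        (measurable_normSq.comp hvm)).symm
    have h2 : ∫⁻ z, normSq (v z) ∂((leb Ω).compProd (toKernel hμ))
        = ∫⁻ z, ∑ i, ‖w i z‖ₑ ^ 2 ∂ν :=
      MeasurePreserving.lintegral_comp ⟨hSm, hmap⟩
        (Finset.measurable_sum _ fun i _ => (hwm i).enorm.pow_const 2)
    rw [h1, h2, hsum, lintegral_finsetSum _ fun i _ => (hwm i).enorm.pow_const 2]
    refine Finset.sum_le_sum fun i _ => ?_
    rw [lintegral_enorm_sq_Lp]
    calc ‖w i‖ₑ ^ 2 ≤ ‖(hmem i).toLp _‖ₑ ^ 2 := by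
          gcongr
          exact enorm_condMean_le hT _
      _ = ∫⁻ z, ‖g z i‖ₑ ^ 2 ∂P := by
          rw [← lintegral_enorm_sq_Lp]
          refine lintegral_congr_ae ?_
          filter_upwards [(hmem i).coeFn_toLp] with z hz
          rw [hz]
  have hscalar : ∀ (i : Fin (p + 1)) (Φ : TimeCond p × EuclideanSpace ℝ (Fin q) → ℝ),
      ContDiff ℝ (⊤ : ℕ∞) Φ → HasCompactSupport Φ → tsupport Φ ⊆ interior (cyl Ω) ×ˢ univ →
      Integrable (fun z : cyl Ω × EuclideanSpace ℝ (Fin q) =>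
        fderiv ℝ Φ ((z.1 : TimeCond p), z.2) (dir i, w i z)) ν ∧
      ∫ z, fderiv ℝ Φ ((z.1 : TimeCond p), z.2) (dir i, w i z) ∂ν = 0 := by
    intro i Φ hΦ hΦc hΦs
    have hcont : Continuous (fderiv ℝ Φ) := hΦ.continuous_fderiv (by simp)
    obtain ⟨C, hC⟩ := (hΦc.fderiv ℝ).exists_bound_of_continuous hcont
    let A : cyl Ω × EuclideanSpace ℝ (Fin q) → (TimeCond p × EuclideanSpace ℝ (Fin q)) →L[ℝ] ℝ :=
      fun z => fderiv ℝ Φ ((z.1 : TimeCond p), z.2)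
    have hA : StronglyMeasurable A := hcont.comp_stronglyMeasurable
      ((measurable_subtype_coe.comp measurable_fst).prodMk measurable_snd).stronglyMeasurable
    -- Only the `x`-part involves the gradient and is exchanged by `condMean`; the `ξ`-part is a
    -- plain change of variables along `T`.
    have hsplit : ∀ z (k : EuclideanSpace ℝ (Fin q)),
        A z (dir i, k) = A z (0, k) + A z (dir i, 0) := fun z k => by
      rw [← map_add, Prod.mk_add_mk, zero_add, add_zero]
    have hν1 : Integrable (fun z => A z (0, w i z)) ν :=
      integrable_clm_apply_of_bound hA.aestronglyMeasurable (fun z => hC _)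
        ((integrable_const (0 : TimeCond p)).prodMk ((Lp.memLp (w i)).integrable one_le_two))
    have hν2 : Integrable (fun z => A z (dir i, 0)) ν :=
      integrable_clm_apply_of_bound hA.aestronglyMeasurable (fun z => hC _) (integrable_const _)
    have hAT : AEStronglyMeasurable (fun x => A (T x)) P :=
      (hA.comp_measurable hTm).aestronglyMeasurable
    have hP1 : Integrable (fun x => A (T x) (0, g x i)) P :=
      integrable_clm_apply_of_bound hAT (fun z => hC _)
        ((integrable_const (0 : TimeCond p)).prodMk ((hmem i).integrable one_le_two))
    have hP2 : Integrable (fun x => A (T x) (dir i, 0)) P :=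
      integrable_clm_apply_of_bound hAT (fun z => hC _) (integrable_const _)
    have hcm := integral_apply_condMean hT ((hmem i).toLp _)
      (L := fun z => (A z).comp (ContinuousLinearMap.inr ℝ _ _))
      (((compL ℝ _ (TimeCond p × EuclideanSpace ℝ (Fin q)) ℝ).flip
        (ContinuousLinearMap.inr ℝ _ _)).continuous.comp_stronglyMeasurable hA) (C := C * 1) (fun z =>
          (opNorm_comp_le _ _).trans (mul_le_mul (hC _) (norm_inr_le_one ℝ _ _)
            (norm_nonneg _) ((norm_nonneg _).trans (hC 0))))
    have hcm' : ∫ z, A z (0, w i z) ∂ν = ∫ x, A (T x) (0, g x i) ∂P := by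
      refine hcm.trans (integral_congr_ae ?_)
      filter_upwards [(hmem i).coeFn_toLp] with x hx
      rw [hx]
      rfl
    have hcb : ∫ z, A z (dir i, 0) ∂ν = ∫ x, A (T x) (dir i, 0) ∂P :=
      integral_map hTm.aemeasurable hν2.aestronglyMeasurable
    have hPi : Integrable (fun x => A (T x) (dir i, g x i)) P :=
      (hP1.add hP2).congr (Eventually.of_forall fun x => (hsplit (T x) _).symm)
    refine ⟨(hν1.add hν2).congr (Eventually.of_forall fun z => (hsplit z _).symm), ?_⟩
    calc ∫ z, A z (dir i, w i z) ∂ν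
        = ∫ z, A z (0, w i z) + A z (dir i, 0) ∂ν :=
          integral_congr_ae (Eventually.of_forall fun z => hsplit z _)
      _ = ∫ x, A (T x) (0, g x i) + A (T x) (dir i, 0) ∂P := by
          rw [integral_add hν1 hν2, integral_add hP1 hP2, hcm', hcb]
      _ = ∫ x, A (T x) (dir i, g x i) ∂P :=
          integral_congr_ae (Eventually.of_forall fun x => (hsplit (T x) _).symm)
      _ = ∫ y, ∫ ξ, A (T (y, ξ)) (dir i, g (y, ξ) i) ∂(leb Ω) ∂Q := integral_prod _ hPi
      _ = 0 := by
          refine integral_eq_zero_of_ae ?_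
          filter_upwards [hchain] with y hy
          exact hy i Φ hΦ hΦc hΦs
  have hsol : IsSolution Ω D μ v := by
    refine ⟨hμ, hvm, hkin.trans_lt (lt_top_iff_ne_top.2 hfin), fun φ hφ hφc hφs => ?_⟩
    let Φ : Fin (p + 1) → TimeCond p × EuclideanSpace ℝ (Fin q) → ℝ := fun i z => φ z i
    have hΦ : ∀ i, ContDiff ℝ (⊤ : ℕ∞) (Φ i) := fun i => contDiff_pi.1 hφ i
    have hΦc : ∀ i, HasCompactSupport (Φ i) := fun i =>
      hφc.comp_left (g := fun a : Fin (p + 1) → ℝ => a i) rfl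
    have hΦs : ∀ i, tsupport (Φ i) ⊆ interior (cyl Ω) ×ˢ univ := fun i =>
      (closure_mono (Function.support_comp_subset (g := fun a : Fin (p + 1) → ℝ => a i)
        rfl φ)).trans hφs
    have hder : ∀ z h i, fderiv ℝ φ z h i = fderiv ℝ (Φ i) z h := fun z h i => by
      have := hasFDerivAt_pi'.1 (hφ.differentiable (by simp) z).hasFDerivAt i
      rw [this.fderiv]
      rfl
    let H : cyl Ω × EuclideanSpace ℝ (Fin q) → ℝ := fun z =>
      ∑ i, fderiv ℝ (Φ i) ((z.1 : TimeCond p), z.2) (dir i, w i z)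
    have hHi : Integrable H ν :=
      integrable_finsetSum _ fun i _ => (hscalar i (Φ i) (hΦ i) (hΦc i) (hΦs i)).1
    have hH0 : ∫ z, H z ∂ν = 0 := by
      rw [integral_finsetSum _ fun i _ => (hscalar i (Φ i) (hΦ i) (hΦc i) (hΦs i)).1]
      exact Finset.sum_eq_zero fun i _ => (hscalar i (Φ i) (hΦ i) (hΦc i) (hΦs i)).2
    rw [← hmap] at hHi hH0
    rw [integral_map hSm.aemeasurable hHi.aestronglyMeasurable] at hH0
    have hHS := hHi.comp_measurable hSm
    refine Eq.trans ?_ ((Measure.integral_compProd hHS).symm.trans hH0)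
    refine integral_congr_ae (Eventually.of_forall fun ξ => ?_)
    refine integral_congr_ae (Eventually.of_forall fun x => ?_)
    refine Finset.sum_congr rfl fun i _ => ?_
    rw [hder, hder, ← map_add, Prod.mk_add_mk, zero_add, add_zero]
  refine (iInf₂_le v hsol).trans (le_trans ?_ hkin)
  -- The factor `1/2` of the Dirichlet energy is simply discarded.
  exact mul_le_of_le_one_left zero_le (by simp)

end Representation

/-! ### Joint measurability of families of `L²` classes -/

/-- A continuous family of classes in `L²` has a jointly measurable representative. -/
theorem exists_measurable_representative {X Y F : Type*} [MeasurableSpace X] {m : Measure X}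
    [TopologicalSpace Y] [MeasurableSpace Y] [OpensMeasurableSpace Y]
    [NormedAddCommGroup F] [CompleteSpace F] [MeasurableSpace F] [BorelSpace F]
    [SecondCountableTopology F]
    [SecondCountableTopology (Lp F 2 m)] {f : Y → Lp F 2 m} (hf : Continuous f) :
    ∃ G : Y × X → F, Measurable G ∧ ∀ y, ∀ᵐ x ∂m, G (y, x) = f y x := by
  let d : ℕ → Lp F 2 m := TopologicalSpace.denseSeq _
  have hd : ∀ (n : ℕ) (y : Y), ∃ k, ‖d k - f y‖ < (1 / 2) ^ n := fun n y => by
    obtain ⟨k, hk⟩ := (TopologicalSpace.denseRange_denseSeq (Lp F 2 m)).exists_dist_lt (f y)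
      (ε := (1 / 2) ^ n) (by positivity)
    exact ⟨k, by rwa [dist_comm, dist_eq_norm] at hk⟩
  classical
  -- The first member of a dense sequence within `2⁻ⁿ` of `f y` depends measurably on `y`. The
  -- errors are summable in `L²`, which forces almost everywhere convergence.
  let N : ℕ → Y → ℕ := fun n y => Nat.find (hd n y)
  have hN : ∀ n, Measurable (N n) := fun n => measurable_find _ fun k =>
    (isOpen_lt (continuous_const.sub hf).norm continuous_const).measurableSet
  have hdm : Measurable fun z : ℕ × X => d z.1 z.2 :=
    measurable_from_prod_countable_right fun k => (Lp.stronglyMeasurable (d k)).measurable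
  let a : ℕ → Y × X → F := fun n z => d (N n z.1) z.2
  have ham : ∀ n, Measurable (a n) := fun n =>
    hdm.comp (((hN n).comp measurable_fst).prodMk measurable_snd)
  refine ⟨fun z => limUnder atTop fun n => a n z,
    (StronglyMeasurable.limUnder fun n => (ham n).stronglyMeasurable).measurable, fun y => ?_⟩
  have hsum : ∑' n, eLpNorm (d (N n y) - f y : Lp F 2 m) 2 m ≠ ⊤ := by
    have hle : ∀ n, eLpNorm (d (N n y) - f y : Lp F 2 m) 2 m ≤ ENNReal.ofReal ((1 / 2) ^ n) := by
      intro n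
      rw [← Lp.enorm_def, ← ofReal_norm]
      exact ENNReal.ofReal_le_ofReal (Nat.find_spec (hd n y)).le
    refine ne_top_of_le_ne_top ?_ (ENNReal.tsum_le_tsum hle)
    rw [← ENNReal.ofReal_tsum_of_nonneg (fun n => by positivity) summable_geometric_two]
    exact ENNReal.ofReal_ne_top
  have hsm := summable_norm_of_tsum_eLpNorm_ne_top one_le_two
    (fun n => Lp.aestronglyMeasurable (d (N n y) - f y)) hsum
  have hsub : ∀ᵐ x ∂m, ∀ n, (d (N n y) - f y : Lp F 2 m) x = d (N n y) x - f y x :=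
    ae_all_iff.2 fun n => Lp.coeFn_sub _ _
  filter_upwards [hsm, hsub] with x hx hx'
  have h0 := tendsto_zero_iff_norm_tendsto_zero.2 hx.tendsto_atTop_zero
  simp only [hx'] at h0
  exact (tendsto_sub_nhds_zero_iff.1 h0).limUnder_eq

/-! ### Passing between the cylinder and the whole space -/

section Cylinder

variable {p q : ℕ} {Ω : Set (EuclideanSpace ℝ (Fin p))} {D : Set (EuclideanSpace ℝ (Fin q))}

theorem measurableSet_cyl (hΩ : IsOpen Ω) : MeasurableSet (cyl Ω) :=
  measurableSet_Icc.prod hΩ.measurableSet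

theorem isFiniteMeasure_leb (hΩ : IsOpen Ω) (hb : Bornology.IsBounded Ω) :
    IsFiniteMeasure (leb Ω) := by
  refine ⟨?_⟩
  rw [leb, (MeasurableEmbedding.subtype_coe (measurableSet_cyl hΩ)).comap_apply, image_univ,
    Subtype.range_coe]
  exact (Bornology.IsBounded.prod (Metric.isBounded_Icc 0 1) hb).measure_lt_top

theorem integral_leb_eq_of_forall_notMem (hΩ : IsOpen Ω) {G : Type*} [NormedAddCommGroup G]
    [NormedSpace ℝ G] {H : TimeCond p → G} (hH : ∀ ξ ∉ cyl Ω, H ξ = 0) :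
    ∫ ξ : cyl Ω, H ξ ∂(leb Ω) = ∫ ξ, H ξ := by
  rw [leb, integral_subtype_comap (measurableSet_cyl hΩ)]
  exact setIntegral_eq_integral_of_forall_compl_eq_zero hH

instance (p : ℕ) : (volume : Measure (TimeCond p)).IsAddHaarMeasure :=
  Measure.prod.instIsAddHaarMeasure _ _

/-- Extension by zero of a function on `I × Ω`. -/
def zeroExt {G : Type*} [Zero G] (u : cyl Ω → G) : TimeCond p → G :=
  Function.extend Subtype.val u 0

theorem zeroExt_coe {G : Type*} [Zero G] (u : cyl Ω → G) (ξ : cyl Ω) :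
    zeroExt u (ξ : TimeCond p) = u ξ :=
  Subtype.val_injective.extend_apply _ _ _

theorem zeroExt_of_notMem {G : Type*} [Zero G] (u : cyl Ω → G) {ξ : TimeCond p} (h : ξ ∉ cyl Ω) :
    zeroExt u ξ = 0 :=
  Function.extend_apply' _ _ _ (by simpa using h)

theorem integrable_zeroExt (hΩ : IsOpen Ω) {G : Type*} [NormedAddCommGroup G]
    {u : cyl Ω → G} (hu : Integrable u (leb Ω)) : Integrable (zeroExt u) := by
  have he := MeasurableEmbedding.subtype_coe (measurableSet_cyl hΩ)
  have h1 : zeroExt u ∘ Subtype.val = u := funext (zeroExt_coe u)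
  have h2 : IntegrableOn (zeroExt u) (cyl Ω) := by
    rw [IntegrableOn, ← map_comap_subtype_coe (measurableSet_cyl hΩ), he.integrable_map_iff, h1]
    exact hu
  refine (integrableOn_iff_integrable_of_support_subset fun ξ hξ => ?_).1 h2
  by_contra hn
  exact hξ (zeroExt_of_notMem u hn)

theorem IsWeakPartial.hasWeakDerivOn (hΩ : IsOpen Ω) {i : Fin (p + 1)}
    {u g : cyl Ω → EuclideanSpace ℝ (Fin q)} (h : IsWeakPartial i u g) :
    HasWeakDerivOn volume (interior (cyl Ω)) (dir i) (zeroExt u) (zeroExt g) := by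
  intro φ hφ hφc hφs
  have := h φ hφ hφc hφs
  simp_rw [← zeroExt_coe u, ← zeroExt_coe g] at this
  rwa [integral_leb_eq_of_forall_notMem hΩ (H := fun ξ => fderiv ℝ φ ξ (dir i) • zeroExt u ξ)
      fun ξ hξ => by rw [zeroExt_of_notMem u hξ, smul_zero],
    integral_leb_eq_of_forall_notMem hΩ (H := fun ξ => φ ξ • zeroExt g ξ)
      fun ξ hξ => by rw [zeroExt_of_notMem g hξ, smul_zero]] at this

/-- The values of `u` and `g` off the cylinder are irrelevant, since the derivative of `Φ` vanishes
there. -/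
theorem integral_leb_fderiv_eq (hΩ : IsOpen Ω)
    {Φ : TimeCond p × EuclideanSpace ℝ (Fin q) → ℝ} (hΦs : tsupport Φ ⊆ interior (cyl Ω) ×ˢ univ)
    (i : Fin (p + 1)) (u g : TimeCond p → EuclideanSpace ℝ (Fin q)) :
    ∫ ξ : cyl Ω, fderiv ℝ Φ ((ξ : TimeCond p), u ξ) (dir i, g ξ) ∂(leb Ω)
      = ∫ ξ, fderiv ℝ Φ (ξ, u ξ) (dir i, g ξ) := by
  refine integral_leb_eq_of_forall_notMem hΩ
    (H := fun ξ => fderiv ℝ Φ (ξ, u ξ) (dir i, g ξ)) fun ξ hξ => ?_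
  have : ξ ∉ Prod.fst '' tsupport Φ := by
    rintro ⟨z, hz, rfl⟩
    exact hξ (interior_subset (hΦs hz).1)
  simp [(eq_zero_of_notMem_fst_tsupport this (u ξ)).2]

theorem SatisfiesChainRule.congr {u u' : cyl Ω → EuclideanSpace ℝ (Fin q)}
    {g g' : cyl Ω → Columns p q} (h : SatisfiesChainRule u g) (hu : u' =ᵐ[leb Ω] u)
    (hg : g' =ᵐ[leb Ω] g) : SatisfiesChainRule u' g' := by
  intro i Φ hΦ hΦc hΦs
  rw [← h i Φ hΦ hΦc hΦs]
  refine integral_congr_ae ?_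
  filter_upwards [hu, hg] with ξ h1 h2
  rw [h1, h2]

end Cylinder

/-! ### Mixtures of Sobolev maps -/

section Sobolev

variable {p q : ℕ} {Ω : Set (EuclideanSpace ℝ (Fin p))} {D : Set (EuclideanSpace ℝ (Fin q))}

theorem SobolevMap.satisfiesChainRule (hΩ : IsOpen Ω) (hb : Bornology.IsBounded Ω)
    (ψ : SobolevMap Ω D) : SatisfiesChainRule ψ.val ψ.grad := by
  have := isFiniteMeasure_leb hΩ hb
  intro i Φ hΦ hΦc hΦs
  have hint : ∀ f : Lp (EuclideanSpace ℝ (Fin q)) 2 (leb Ω), Integrable (zeroExt f) := fun f =>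
    integrable_zeroExt hΩ ((Lp.memLp f).integrable one_le_two)
  have h := (ψ.2.2 i).hasWeakDerivOn hΩ |>.integral_chain_eq_zero isOpen_interior
    (hint _) (hint _) (hΦ.of_le (by simp)) hΦc hΦs
  rw [← integral_leb_fderiv_eq hΩ hΦs] at h
  simp_rw [zeroExt_coe] at h
  exact h

theorem dirichletEnergy_le_of_isSobolevMixture (hΩ : IsOpen Ω) (hb : Bornology.IsBounded Ω)
    (Q : Measure (SobolevMap Ω D)) [IsProbabilityMeasure Q] {μ : cyl Ω → ProbabilityMeasure D}
    (h : IsSobolevMixture Q μ) :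
    dirichletEnergy Ω D μ ≤ ∫⁻ ψ, ∫⁻ ξ : cyl Ω, normSq (ψ.grad ξ) ∂(leb Ω) ∂Q := by
  have := isFiniteMeasure_leb hΩ hb
  have : Fact ((2 : ℝ≥0∞) ≠ ⊤) := ⟨by simp⟩
  obtain ⟨hμ, hA⟩ := h
  have hc : Continuous fun ψ : SobolevMap Ω D => ψ.1 := continuous_induced_dom
  -- `SobolevMap.val` picks a representative for each `ψ` separately, with no measurability in `ψ`,
  -- so jointly measurable versions of the map and its gradient take its place.
  obtain ⟨u, hum, hu⟩ := exists_measurable_representative (continuous_fst.comp hc)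
  choose g' hgm' hg' using fun i : Fin (p + 1) => exists_measurable_representative
    ((continuous_apply i).comp (continuous_snd.comp hc))
  let g : SobolevMap Ω D × cyl Ω → Columns p q := fun z i => g' i z
  have hgm : Measurable g := measurable_pi_lambda _ hgm'
  have hg : ∀ ψ, (fun ξ => g (ψ, ξ)) =ᵐ[leb Ω] ψ.grad := fun ψ => by
    filter_upwards [ae_all_iff.2 fun i => hg' i ψ] with ξ hξ
    exact funext hξ
  have hE : ∫⁻ z, normSq (g z) ∂(Q.prod (leb Ω))
      = ∫⁻ ψ, ∫⁻ ξ : cyl Ω, normSq (ψ.grad ξ) ∂(leb Ω) ∂Q := by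
    rw [lintegral_prod (fun z => normSq (g z)) (measurable_normSq.comp hgm).aemeasurable]
    refine lintegral_congr fun ψ => lintegral_congr_ae ?_
    filter_upwards [hg ψ] with ξ hξ
    rw [hξ]
  by_cases hfin : ∫⁻ z, normSq (g z) ∂(Q.prod (leb Ω)) = ⊤
  · rw [← hE, hfin]
    exact le_top
  rw [← hE]
  refine dirichletEnergy_le_of_random_map Q hμ hum hgm hfin ?_ (Eventually.of_forall fun ψ =>
    (ψ.satisfiesChainRule hΩ hb).congr (hu ψ) (hg ψ))
  ext A hAm
  have hSm : Measurable fun z : cyl Ω × D => (z.1, (z.2 : EuclideanSpace ℝ (Fin q))) :=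
    measurable_fst.prodMk (measurable_subtype_coe.comp measurable_snd)
  have hTm : Measurable fun z : SobolevMap Ω D × cyl Ω => (z.2, u z) := measurable_snd.prodMk hum
  rw [Measure.map_apply hSm hAm, Measure.map_apply hTm hAm,
    Measure.compProd_apply (hSm hAm), Measure.prod_apply (hTm hAm)]
  refine (hA A hAm).trans (lintegral_congr fun ψ => ?_)
  rw [← lintegral_indicator_one (measurable_prodMk_left (hTm hAm))]
  refine lintegral_congr_ae ?_
  filter_upwards [hu ψ] with ξ hξ
  refine (Measure.dirac_apply' _ (measurable_prodMk_left hAm)).trans ?_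
  rw [show ψ.val ξ = u (ψ, ξ) from hξ.symm]
  rfl

end Sobolev

/-! ### Mixtures of differentiable maps -/

section Differentiable

variable {p q : ℕ} {Ω : Set (EuclideanSpace ℝ (Fin p))} {D : Set (EuclideanSpace ℝ (Fin q))}

theorem ae_mem_interior_cyl (hΩ : IsOpen Ω) :
    ∀ᵐ ξ : cyl Ω ∂(leb Ω), (ξ : TimeCond p) ∈ interior (cyl Ω) := by
  have hnull : volume ({0, 1} ×ˢ univ : Set (TimeCond p)) = 0 := by
    rw [Measure.volume_eq_prod, Measure.prod_prod, (toFinite {(0 : ℝ), 1}).measure_zero, zero_mul]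
  have h : ∀ᵐ ξ : TimeCond p, ξ ∈ cyl Ω → ξ ∈ interior (cyl Ω) := by
    filter_upwards [measure_eq_zero_iff_ae_notMem.1 hnull] with ξ hξ hm
    rw [interior_prod_eq, interior_Icc, hΩ.interior_eq]
    refine ⟨⟨hm.1.1.lt_of_ne fun h => hξ ⟨Or.inl h.symm, trivial⟩,
      hm.1.2.lt_of_ne fun h => hξ ⟨Or.inr h, trivial⟩⟩, hm.2⟩
  rw [← ae_restrict_iff' (measurableSet_cyl hΩ),
    ← map_comap_subtype_coe (measurableSet_cyl hΩ)] at h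
  exact ae_of_ae_map measurable_subtype_coe.aemeasurable h

theorem DiffMap.continuous (ψ : DiffMap Ω D) : Continuous ψ.1 := by
  refine continuous_induced_rng.2 ?_
  have h := continuousOn_iff_continuous_domRestrict.1 ψ.2.continuousOn
  refine h.congr fun ξ => ?_
  exact zeroExt_coe (fun ξ => (ψ.1 ξ : EuclideanSpace ℝ (Fin q))) ξ

/-- A Carathéodory function: continuous in `ξ`, measurable in `ψ`. -/
theorem DiffMap.measurable_uncurry_eval :
    Measurable fun z : DiffMap Ω D × cyl Ω => z.1.1 z.2 := by
  have h := measurable_uncurry_of_continuous_of_measurable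
    (u := fun (ξ : cyl Ω) (ψ : DiffMap Ω D) => ψ.1 ξ) DiffMap.continuous DiffMap.measurable_eval
  exact h.comp measurable_swap

theorem DiffMap.measurable_uncurry_extend (hΩ : IsOpen Ω) :
    Measurable fun z : DiffMap Ω D × TimeCond p => extend Ω D z.1.1 z.2 := by
  have he : MeasurableEmbedding (Prod.map id Subtype.val :
      DiffMap Ω D × cyl Ω → DiffMap Ω D × TimeCond p) :=
    MeasurableEmbedding.id.prodMap (MeasurableEmbedding.subtype_coe (measurableSet_cyl hΩ))
  have hm := he.measurable_extend (g' := fun _ => 0) (measurable_subtype_coe.comp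
    DiffMap.measurable_uncurry_eval) measurable_const
  refine (congrArg Measurable ?_).mp hm
  funext ⟨ψ, ξ⟩
  by_cases hξ : ξ ∈ cyl Ω
  · lift ξ to cyl Ω using hξ
    refine (he.injective.extend_apply _ _ (ψ, ξ)).trans ?_
    exact (zeroExt_coe (fun ξ => (ψ.1 ξ : EuclideanSpace ℝ (Fin q))) ξ).symm
  · rw [Function.extend_apply']
    · exact (zeroExt_of_notMem (fun ξ => (ψ.1 ξ : EuclideanSpace ℝ (Fin q))) hξ).symm
    · rintro ⟨⟨ψ', ξ'⟩, h⟩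
      have h' : (ξ' : TimeCond p) = ξ := congrArg Prod.snd h
      exact hξ (h' ▸ ξ'.2)

/-- The gradient in the interior of the cylinder, extended by zero to its boundary. -/
def DiffMap.interiorGrad (ψ : DiffMap Ω D) (ξ : cyl Ω) : Columns p q :=
  (Subtype.val ⁻¹' interior (cyl Ω)).indicator ψ.grad ξ

theorem DiffMap.interiorGrad_ae_eq (hΩ : IsOpen Ω) (ψ : DiffMap Ω D) :
    ψ.interiorGrad =ᵐ[leb Ω] ψ.grad := by
  filter_upwards [ae_mem_interior_cyl hΩ] with ξ hξ
  exact indicator_of_mem (s := Subtype.val ⁻¹' interior (cyl Ω)) hξ _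

theorem DiffMap.differentiableAt (ψ : DiffMap Ω D) {ξ : TimeCond p} (h : ξ ∈ interior (cyl Ω)) :
    DifferentiableAt ℝ (extend Ω D ψ.1) ξ :=
  ψ.2.differentiableAt (mem_interior_iff_mem_nhds.1 h)

theorem DiffMap.interiorGrad_eq_fderiv (ψ : DiffMap Ω D) {ξ : cyl Ω}
    (h : (ξ : TimeCond p) ∈ interior (cyl Ω)) (i : Fin (p + 1)) :
    ψ.interiorGrad ξ i = fderiv ℝ (extend Ω D ψ.1) ξ (dir i) := by
  rw [interiorGrad, indicator_of_mem (s := Subtype.val ⁻¹' interior (cyl Ω)) h, DiffMap.grad,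
    fderivWithin_of_mem_nhds (mem_interior_iff_mem_nhds.1 h)]

/-- In the interior the gradient is the limit of difference quotients with step `1/n`. At the faces
`t = 0, 1` the shifted point may leave the cylinder, where the extension is zero, so the gradient is
cut off there. -/
theorem DiffMap.measurable_interiorGrad (hΩ : IsOpen Ω) :
    Measurable fun z : DiffMap Ω D × cyl Ω => z.1.interiorGrad z.2 := by
  refine measurable_pi_lambda _ fun i => ?_
  have hs : MeasurableSet {z : DiffMap Ω D × cyl Ω | (z.2 : TimeCond p) ∈ interior (cyl Ω)} :=
    (measurable_subtype_coe.comp measurable_snd) isOpen_interior.measurableSet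
  have hc : Measurable fun z : DiffMap Ω D × cyl Ω => (z.2 : TimeCond p) :=
    measurable_subtype_coe.comp measurable_snd
  refine measurable_of_tendsto_metrizable (f := fun (n : ℕ) (z : DiffMap Ω D × cyl Ω) =>
    {z : DiffMap Ω D × cyl Ω | (z.2 : TimeCond p) ∈ interior (cyl Ω)}.indicator
      (fun z => (n : ℝ) • (extend Ω D z.1.1 (z.2 + (n : ℝ)⁻¹ • dir i) - extend Ω D z.1.1 z.2)) z)
    (fun n => ?_) ?_
  · refine Measurable.indicator (Measurable.fun_const_smul (Measurable.fun_sub ?_ ?_) _) hs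
    · exact (DiffMap.measurable_uncurry_extend hΩ).comp
        (measurable_fst.prodMk (hc.add_const _))
    · exact (DiffMap.measurable_uncurry_extend hΩ).comp (measurable_fst.prodMk hc)
  · refine tendsto_pi_nhds.2 fun z => ?_
    by_cases hz : (z.2 : TimeCond p) ∈ interior (cyl Ω)
    · simp only [z.1.interiorGrad_eq_fderiv hz]
      refine ((z.1.differentiableAt hz).hasFDerivAt.lim (dir i) (c := fun n : ℕ => (n : ℝ))
        ?_).congr fun n => (indicator_of_mem (by exact hz) _).symm
      simpa using tendsto_natCast_atTop_atTop (R := ℝ)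
    · have h0 : z.1.interiorGrad z.2 = 0 :=
        indicator_of_notMem (s := Subtype.val ⁻¹' interior (cyl Ω)) hz _
      rw [h0]
      refine tendsto_const_nhds.congr fun n => (indicator_of_notMem (by exact hz) _).symm

/-- Integrability is a genuine hypothesis: an everywhere differentiable map may have a
non-integrable gradient. -/
theorem DiffMap.satisfiesChainRule (hΩ : IsOpen Ω) (ψ : DiffMap Ω D)
    (hi : ∀ i, Integrable (fun ξ => ψ.interiorGrad ξ i) (leb Ω)) :
    SatisfiesChainRule (fun ξ => (ψ.1 ξ : EuclideanSpace ℝ (Fin q))) ψ.interiorGrad := by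
  intro i Φ hΦ hΦc hΦs
  have hw : ∀ ξ : cyl Ω, (ψ.1 ξ : EuclideanSpace ℝ (Fin q)) = extend Ω D ψ.1 ξ := fun ξ =>
    (zeroExt_coe (fun ξ => (ψ.1 ξ : EuclideanSpace ℝ (Fin q))) ξ).symm
  have hg : ∀ ξ : cyl Ω, ψ.interiorGrad ξ i = zeroExt (fun ξ => ψ.interiorGrad ξ i) ξ := fun ξ =>
    (zeroExt_coe (fun ξ => ψ.interiorGrad ξ i) ξ).symm
  refine (integral_congr_ae (Eventually.of_forall fun ξ => ?_)).trans
    ((integral_leb_fderiv_eq hΩ hΦs i (extend Ω D ψ.1)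
      (zeroExt fun ξ => ψ.interiorGrad ξ i)).trans ?_)
  · change fderiv ℝ Φ (ξ, (ψ.1 ξ : EuclideanSpace ℝ (Fin q))) (dir i, ψ.interiorGrad ξ i) = _
    rw [hw ξ, hg ξ]
  have hKU : Prod.fst '' tsupport Φ ⊆ interior (cyl Ω) := by
    rintro _ ⟨z, hz, rfl⟩
    exact (hΦs hz).1
  have hK : IsCompact (Prod.fst '' tsupport Φ) := hΦc.isCompact.image continuous_fst
  have heq : (fun ξ => fderiv ℝ Φ (ξ, extend Ω D ψ.1 ξ)
        (dir i, zeroExt (fun ξ => ψ.interiorGrad ξ i) ξ))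
      = fun ξ => fderiv ℝ Φ (ξ, extend Ω D ψ.1 ξ) (dir i, fderiv ℝ (extend Ω D ψ.1) ξ (dir i)) := by
    funext ξ
    by_cases hξ : ξ ∈ Prod.fst '' tsupport Φ
    · have hc := interior_subset (hKU hξ)
      rw [← ψ.interiorGrad_eq_fderiv (ξ := ⟨ξ, hc⟩) (hKU hξ),
        ← zeroExt_coe (fun ξ => ψ.interiorGrad ξ i) ⟨ξ, hc⟩]
    · simp [(eq_zero_of_notMem_fst_tsupport hξ (extend Ω D ψ.1 ξ)).2]
  have hm : Measurable (extend Ω D ψ.1) :=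
    (DiffMap.measurable_uncurry_extend hΩ).comp (measurable_prodMk_left (x := ψ))
  have hint := integrable_fderiv_apply (m := volume) (hΦ.of_le (by simp)) hΦc
    hm.aestronglyMeasurable (h := fun ξ => (dir i, zeroExt (fun ξ => ψ.interiorGrad ξ i) ξ))
    (Integrable.prodMk (integrableOn_const (C := dir i) hK.measure_lt_top.ne (by simp))
      (integrable_zeroExt hΩ (hi i)).integrableOn)
  rw [heq] at hint ⊢
  exact integral_chain_eq_zero_of_differentiableAt (hΦ.of_le (by simp)) hΦc
    (fun ξ hξ => ψ.differentiableAt (hKU hξ)) hint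

theorem mixture_apply (Q : Measure (DiffMap Ω D)) [IsProbabilityMeasure Q] (ξ : cyl Ω)
    {s : Set D} (hs : MeasurableSet s) :
    (mixture Q ξ : Measure D) s = Q ((fun ψ => ψ.1 ξ) ⁻¹' s) := by
  rw [← Measure.map_apply (DiffMap.measurable_eval ξ) hs]
  exact congrArg (fun m : Measure D => m s)
    (Measure.bind_dirac_eq_map Q (DiffMap.measurable_eval ξ))

theorem measurable_mixture (Q : Measure (DiffMap Ω D)) [IsProbabilityMeasure Q] :
    Measurable (mixture Q) := by
  refine Measurable.subtype_mk (f := fun ξ => (mixture Q ξ : Measure D)) ?_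
  refine Measure.measurable_of_measurable_coe _ fun s hs => ?_
  simp_rw [mixture_apply Q _ hs]
  exact measurable_measure_prodMk_right (DiffMap.measurable_uncurry_eval hs)

theorem dirichletEnergy_mixture_le (hΩ : IsOpen Ω) (hb : Bornology.IsBounded Ω)
    (Q : Measure (DiffMap Ω D)) [IsProbabilityMeasure Q] :
    dirichletEnergy Ω D (mixture Q)
      ≤ ∫⁻ ξ : cyl Ω, ∫⁻ ψ, normSq (ψ.grad ξ) ∂Q ∂(leb Ω) := by
  have := isFiniteMeasure_leb hΩ hb
  have hgm : Measurable fun z : DiffMap Ω D × cyl Ω => z.1.interiorGrad z.2 :=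
    DiffMap.measurable_interiorGrad hΩ
  have hum : Measurable fun z : DiffMap Ω D × cyl Ω => (z.1.1 z.2 : EuclideanSpace ℝ (Fin q)) :=
    measurable_subtype_coe.comp DiffMap.measurable_uncurry_eval
  have hnm : Measurable fun z : DiffMap Ω D × cyl Ω => normSq (z.1.interiorGrad z.2) :=
    measurable_normSq.comp hgm
  have hE : ∫⁻ z, normSq (z.1.interiorGrad z.2) ∂(Q.prod (leb Ω))
      = ∫⁻ ξ : cyl Ω, ∫⁻ ψ, normSq (ψ.grad ξ) ∂Q ∂(leb Ω) := by
    rw [lintegral_prod_symm _ hnm.aemeasurable]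
    refine lintegral_congr_ae ?_
    filter_upwards [ae_mem_interior_cyl hΩ] with ξ hξ
    refine lintegral_congr fun ψ => congrArg normSq ?_
    exact indicator_of_mem (s := Subtype.val ⁻¹' interior (cyl Ω)) hξ _
  by_cases hfin : ∫⁻ z, normSq (z.1.interiorGrad z.2) ∂(Q.prod (leb Ω)) = ⊤
  · rw [← hE, hfin]
    exact le_top
  rw [← hE]
  refine dirichletEnergy_le_of_random_map Q (measurable_mixture Q) hum hgm hfin ?_ ?_
  · ext A hA
    have hSm : Measurable fun z : cyl Ω × D => (z.1, (z.2 : EuclideanSpace ℝ (Fin q))) :=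
      measurable_fst.prodMk (measurable_subtype_coe.comp measurable_snd)
    have hTm : Measurable fun z : DiffMap Ω D × cyl Ω =>
        (z.2, (z.1.1 z.2 : EuclideanSpace ℝ (Fin q))) := measurable_snd.prodMk hum
    rw [Measure.map_apply hSm hA, Measure.map_apply hTm hA,
      Measure.compProd_apply (hSm hA), Measure.prod_apply_symm (hTm hA)]
    exact lintegral_congr fun ξ => mixture_apply Q ξ (measurable_prodMk_left (hSm hA))
  -- Finite mean energy gives almost every `ψ` a gradient in `L²`, hence in `L¹` on the bounded
  -- cylinder.
  · rw [lintegral_prod _ hnm.aemeasurable] at hfin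
    filter_upwards [ae_lt_top hnm.lintegral_prod_right' hfin] with ψ hψ
    refine ψ.satisfiesChainRule hΩ fun i => ?_
    have hm : Measurable fun ξ => ψ.interiorGrad ξ i :=
      (measurable_pi_apply i).comp (hgm.comp (measurable_prodMk_left (x := ψ)))
    refine (memLp_two_of_lintegral_ne_top hm.aestronglyMeasurable
      (ne_top_of_le_ne_top hψ.ne ?_)).integrable one_le_two
    exact lintegral_mono fun ξ => Finset.single_le_sum
      (f := fun i => ‖ψ.interiorGrad ξ i‖ₑ ^ 2) (fun _ _ => zero_le) (Finset.mem_univ i)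

end Differentiable

end EFM

end

theorem mainTheorem5 (p q : ℕ) (Ω : Set (EuclideanSpace ℝ (Fin p)))
    (hΩo : IsOpen Ω) (hΩc : IsConnected Ω) (hΩb : Bornology.IsBounded Ω)
    (D : Set (EuclideanSpace ℝ (Fin q))) (hD : IsClosed D) :
    (∀ (Q : Measure (EFM.DiffMap Ω D)) [IsProbabilityMeasure Q],
      EFM.dirichletEnergy Ω D (EFM.mixture Q) ≤
        ∫⁻ ξ : EFM.cyl Ω, ∫⁻ ψ, EFM.normSq (ψ.grad ξ) ∂Q ∂(EFM.leb Ω)) ∧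
    (∀ (Q : Measure (EFM.SobolevMap Ω D)) [IsProbabilityMeasure Q]
      (μ : EFM.cyl Ω → ProbabilityMeasure D), EFM.IsSobolevMixture Q μ →
      EFM.dirichletEnergy Ω D μ ≤
        ∫⁻ ψ, ∫⁻ ξ : EFM.cyl Ω, EFM.normSq (ψ.grad ξ) ∂(EFM.leb Ω) ∂Q) :=
  ⟨fun Q _ => EFM.dirichletEnergy_mixture_le hΩo hΩb Q,
    fun Q _ _ h => EFM.dirichletEnergy_le_of_isSobolevMixture hΩo hΩb Q h⟩
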